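/- Let $G=(V,E)$ be a finite connected simple graph with $n=|V|\ge 2$ vertices, $m=|E|$ edges, vertex degrees $d(v)$ and maximum degree $\Delta(G)$, and let $x\in(0,1)$ (for the zero-field ferromagnetic Ising model on $G$ at inverse temperature $\beta>0$, $x=\tanh\beta$). For $A\subseteq E$ let $\partial A$ be the set of vertices of odd degree in $(V,A)$, let $\mathcal C_k=\{A\subseteq E: |\partial A|=k\}$, and let $\mathcal W=\mathcal C_0\cup\mathcal C_2$. Let $\pi$ be the probability distribution on $\mathcal W$ with $\pi(A)\propto n\,x^{|A|}$ for $A\in\mathcal C_0$ and $\pi(A)\propto 2\,x^{|A|}$ for $A\in\mathcal C_2$. The lazy Prokofiev–Svistunov (worm) chain on $\mathcal W$ has the following transition matrix $P$. From state $A$, choose a vertex $u$ uniformly at random from $V$ if $A\in\mathcal C_0$, and uniformly at random from $\partial A$ if $A\in\mathcal C_2$; choose a uniformly random neighbour $v$ of $u$ in $G$; with probability $a(A,A\triangle uv)$ move to $A\triangle uv$, and otherwise stay at $A$. Here $$a(A,A\triangle uv)=\frac12\begin{cases}\min\left(1,\frac{d(u)}{d(v)}x^{\pm}\right), & A,\ A\triangle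 uv\in\mathcal C_2,\ u\in\partial A,\\ \min(1,x^{\pm}), & \text{otherwise,}\end{cases}$$ where $x^{\pm}=x$ if $uv\notin A$ (the edge is added) and $x^{\pm}=1/x$ if $uv\in A$ (the edge is removed). For $\delta\in(0,1)$ the mixing time is $$t_{\mathrm{mix}}(\delta)=\min\Big\{t\in\mathbb N:\ \max_{A\in\mathcal W}\|P^t(A,\cdot)-\pi\|_{\mathrm{TV}}\le\delta\Big\},\qquad \|\mu-\nu\|_{\mathrm{TV}}=\max_{S\subseteq\mathcal W}|\mu(S)-\nu(S)|.$$ Then for every $\delta\in(0,1)$ this minimum exists and $$t_{\mathrm{mix}}(\delta)\le\frac{1}{2x}\left(\log\frac{8}{x}-\frac{\log\delta}{m}\right)\left(3+\frac{1}{mx}\right)\Delta(G)\,n^6\,m^2 .$$ -/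

import Mathlib

open scoped symmDiff

noncomputable section

namespace MarkovMixing

/-- Total variation distance `max_{S ⊆ Ω} |μ(S) - ν(S)|` of two measures on a finite set,
given by their mass functions. -/
def tvDist {Ω : Type*} [Fintype Ω] (μ ν : Ω → ℝ) : ℝ :=
  ⨆ S : Finset Ω, |∑ a ∈ S, μ a - ∑ a ∈ S, ν a|

/-- Distance to `π` after `t` steps from a worst initial state. -/
def worstDist {Ω : Type*} [Fintype Ω] [DecidableEq Ω] (P : Matrix Ω Ω ℝ) (π : Ω → ℝ)
    (t : ℕ) : ℝ :=
  ⨆ s : Ω, tvDist ((P ^ t) s) π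

/-- `t` is the mixing time: the minimum of the (in particular non-empty) set of times at which
the worst-case distance to `π` is at most `δ`. -/
def IsMixingTime {Ω : Type*} [Fintype Ω] [DecidableEq Ω] (P : Matrix Ω Ω ℝ) (π : Ω → ℝ)
    (δ : ℝ) (t : ℕ) : Prop :=
  IsLeast {t : ℕ | worstDist P π t ≤ δ} t

end MarkovMixing

namespace Worm

variable {V : Type*} [Fintype V] [DecidableEq V]

/-- `∂A`: the vertices of odd degree in the spanning subgraph `(V, A)`. -/
def boundary (A : Finset (Sym2 V)) : Finset V :=
  {v | Odd (A.filter fun e => v ∈ e).card}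

variable (G : SimpleGraph V) [DecidableRel G.Adj]

/-- `C_k`: the edge sets `A ⊆ E` with exactly `k` odd vertices. -/
def config (k : ℕ) : Finset (Finset (Sym2 V)) :=
  {A ∈ G.edgeFinset.powerset | (boundary A).card = k}

/-- The configuration space `C_0 ∪ C_2`. -/
abbrev State : Type _ := {A : Finset (Sym2 V) // A ∈ config G 0 ∪ config G 2}

/-- Unnormalized stationary weight: `n x^|A|` on `C_0` and `2 x^|A|` on `C_2`. -/
def weight (x : ℝ) (A : State G) : ℝ :=
  x ^ A.1.card * (if A.1 ∈ config G 0 then (Fintype.card V : ℝ) else 2)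

/-- The stationary distribution. -/
def stationary (x : ℝ) (A : State G) : ℝ :=
  weight G x A / ∑ B : State G, weight G x B

/-- The set from which the vertex `u` is drawn uniformly: `V` on `C_0`, and `∂A` on `C_2`. -/
def startSet (A : Finset (Sym2 V)) : Finset V :=
  if A ∈ config G 0 then Finset.univ else boundary A

/-- `x^±` for the flip of the edge `e`: `1/x` if `e` is removed, `x` if it is added. -/
def flipFactor (x : ℝ) (A : Finset (Sym2 V)) (e : Sym2 V) : ℝ :=
  if e ∈ A then x⁻¹ else x

/-- Lazy Metropolis acceptance probability `a(A, A ∆ uv)`, where `u` is the vertex drawn first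
and `v` the chosen neighbour of `u`. -/
def accept (x : ℝ) (A : Finset (Sym2 V)) (u v : V) : ℝ :=
  if A ∈ config G 2 ∧ A ∆ {s(u, v)} ∈ config G 2 ∧ u ∈ boundary A then
    1 / 2 * min 1 ((G.degree u : ℝ) / (G.degree v : ℝ) * flipFactor x A s(u, v))
  else
    1 / 2 * min 1 (flipFactor x A s(u, v))

/-- Transition matrix of the lazy Prokofiev–Svistunov chain: draw `u` uniformly from
`startSet A`, draw a uniform neighbour `v` of `u`, then move to `A ∆ uv` with probability
`accept G x A u v` and stay at `A` otherwise. -/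
def transition (x : ℝ) : Matrix (State G) (State G) ℝ := fun A B =>
  ∑ u ∈ startSet G A.1, (1 / ((startSet G A.1).card : ℝ)) *
    ∑ v ∈ G.neighborFinset u, (1 / (G.degree u : ℝ)) *
      ((if B.1 = A.1 ∆ {s(u, v)} then accept G x A.1 u v else 0) +
        (if B = A then 1 - accept G x A.1 u v else 0))

end Worm

end

/-!
Laziness makes `2P - 1` a stochastic matrix, hence a contraction of `L²(π)`, so one step of the
chain lowers the variance by at least the Dirichlet form. A Poincaré inequality with constant `C`
therefore gives variance decay at rate `1 - 1 / C`, and a variance below `δ² min π` forces total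
variation distance at most `δ`.

The Poincaré inequality comes from canonical paths. An even set `F ∈ C_0` is joined to `F ∆ D`, for
`D ∈ W`, by flipping the edges of `D` in an order that keeps the remaining part of `D` in `W`, so
that the path stays in `W`. If the edges flipped so far form `S ⊆ D`, then `F ∆ S` and `D` recover
`F`, and `|F| + |F ∆ D| = |F ∆ S| + |F ∆ S ∆ D|`. The congestion of a flip at `A` is thereby bounded
by `x ^ |A|` times `∑ D ∈ W, x ^ |A ∆ D|`. Sorted by the boundary of `D`, this is a sum of at most
`n²` partition functions with prescribed boundary, and in the high-temperature expansion each of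
them is a spin correlation, hence at most the partition function of `C_0`.
-/
namespace MarkovMixing

open Matrix

variable {Ω : Type*} [Fintype Ω] {P : Matrix Ω Ω ℝ} {π : Ω → ℝ}

/-- The Dirichlet form of the transition matrix `P` with respect to the mass function `π`. -/
noncomputable def dirichletForm (P : Matrix Ω Ω ℝ) (π f : Ω → ℝ) : ℝ :=
  1 / 2 * ∑ a, ∑ b, π a * P a b * (f a - f b) ^ 2

/-- The variance of `f` under the mass function `π`, as second moment minus squared mean. -/
def variance (π f : Ω → ℝ) : ℝ :=
  π ⬝ᵥ f ^ 2 - (π ⬝ᵥ f) ^ 2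

/-- The Poincaré inequality with constant `C`, which for a reversible chain says that the spectral
gap is at least `1 / C`. -/
def PoincareInequality (P : Matrix Ω Ω ℝ) (π : Ω → ℝ) (C : ℝ) : Prop :=
  ∀ f : Ω → ℝ, variance π f ≤ C * dirichletForm P π f

theorem sum_mul_sub_centerMass_sq_le {ι : Type*} {s : Finset ι} {w : ι → ℝ}
    (hw : ∀ i ∈ s, 0 ≤ w i) (hsum : 0 < ∑ i ∈ s, w i) (p : ι → ℝ) (a : ℝ) :
    (∑ i ∈ s, w i) * (a - s.centerMass w p) ^ 2 ≤ ∑ i ∈ s, w i * (a - p i) ^ 2 := by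
  have hconvex : ConvexOn ℝ Set.univ fun y : ℝ => (y + -a) ^ 2 :=
    (even_two.convexOn_pow (𝕜 := ℝ)).translate_left (-a)
  have hjensen := hconvex.map_centerMass_le hw hsum fun i _ => Set.mem_univ (p i)
  nth_rw 2 [Finset.centerMass] at hjensen
  rw [smul_eq_mul, le_inv_mul_iff₀ hsum] at hjensen
  simpa only [← sub_eq_add_neg, sub_sq_comm _ a, Function.comp_apply, smul_eq_mul] using hjensen

theorem dotProduct_sub_const_sq (hπ : π ∈ stdSimplex ℝ Ω) (f : Ω → ℝ) (c : ℝ) :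
    ∑ a, π a * (f a - c) ^ 2 = variance π f + (π ⬝ᵥ f - c) ^ 2 := by
  have hexpand : ∑ a, π a * (f a - c) ^ 2 = π ⬝ᵥ f ^ 2 - 2 * c * π ⬝ᵥ f + c ^ 2 * ∑ a, π a := by
    simp only [dotProduct, Pi.pow_apply, Finset.mul_sum, ← Finset.sum_add_distrib,
      ← Finset.sum_sub_distrib]
    exact Finset.sum_congr rfl fun a _ => by ring
  rw [hexpand, hπ.2, variance]
  ring

theorem dirichletForm_smul (c : ℝ) (f : Ω → ℝ) :
    dirichletForm P (c • π) f = c * dirichletForm P π f := by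
  simp only [dirichletForm, Pi.smul_apply, smul_eq_mul, mul_assoc, ← Finset.mul_sum]
  ring

theorem variance_indicator_le_one (π : Ω → ℝ) (S : Finset Ω) :
    variance π ((S : Set Ω).indicator 1) ≤ 1 := by
  have hsq : (S : Set Ω).indicator (1 : Ω → ℝ) ^ 2 = (S : Set Ω).indicator 1 := by
    ext a
    by_cases ha : a ∈ S <;> simp [ha]
  rw [variance, hsq]
  nlinarith [sq_nonneg (π ⬝ᵥ (S : Set Ω).indicator 1 - 1 / 2)]

theorem dotProduct_indicator_one (μ : Ω → ℝ) (S : Finset Ω) :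
    μ ⬝ᵥ (S : Set Ω).indicator 1 = ∑ a ∈ S, μ a := by
  classical simp [dotProduct, Set.indicator_apply]

variable [DecidableEq Ω]

theorem vecMul_eq_self_of_detailedBalance (hP : P ∈ rowStochastic ℝ Ω)
    (hbal : ∀ a b, π a * P a b = π b * P b a) : π ᵥ* P = π := by
  ext b
  calc ∑ a, π a * P a b = ∑ a, π b * P b a := Finset.sum_congr rfl fun a _ => hbal a b
    _ = π b := by rw [← Finset.mul_sum, sum_row_of_mem_rowStochastic hP, mul_one]

theorem dirichletForm_eq_sub (hP : P ∈ rowStochastic ℝ Ω) (hstat : π ᵥ* P = π) (f : Ω → ℝ) :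
    dirichletForm P π f = π ⬝ᵥ f ^ 2 - π ⬝ᵥ (f * P *ᵥ f) := by
  have hleft : ∑ a, ∑ b, π a * P a b * f a ^ 2 = π ⬝ᵥ f ^ 2 :=
    Finset.sum_congr rfl fun a _ => by
      rw [← Finset.sum_mul, ← Finset.mul_sum, sum_row_of_mem_rowStochastic hP, mul_one,
        Pi.pow_apply]
  have hright : ∑ a, ∑ b, π a * P a b * f b ^ 2 = π ⬝ᵥ f ^ 2 := by
    rw [Finset.sum_comm]
    nth_rewrite 2 [← hstat]
    exact Finset.sum_congr rfl fun b _ => (Finset.sum_mul _ _ _).symm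
  have hcross : ∑ a, ∑ b, π a * P a b * (f a * f b) = π ⬝ᵥ (f * P *ᵥ f) := by
    simp only [dotProduct, mulVec, Pi.mul_apply, Finset.mul_sum]
    exact Finset.sum_congr rfl fun a _ => Finset.sum_congr rfl fun b _ => by ring
  have hexpand : ∑ a, ∑ b, π a * P a b * (f a - f b) ^ 2 =
      ∑ a, ∑ b, π a * P a b * f a ^ 2 + ∑ a, ∑ b, π a * P a b * f b ^ 2
        - 2 * ∑ a, ∑ b, π a * P a b * (f a * f b) := by
    simp only [Finset.mul_sum, ← Finset.sum_add_distrib, ← Finset.sum_sub_distrib]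
    exact Finset.sum_congr rfl fun a _ => Finset.sum_congr rfl fun b _ => by ring
  rw [dirichletForm, hexpand, hleft, hright, hcross]
  ring

theorem dotProduct_mulVec_sq_le (hP : P ∈ rowStochastic ℝ Ω) (hπ : ∀ a, 0 ≤ π a)
    (hstat : π ᵥ* P = π) (f : Ω → ℝ) : π ⬝ᵥ (P *ᵥ f) ^ 2 ≤ π ⬝ᵥ f ^ 2 := by
  have hjensen : ∀ a, ((P *ᵥ f) ^ 2) a ≤ (P *ᵥ f ^ 2) a := fun a =>
    Real.pow_arith_mean_le_arith_mean_pow_of_even _ _ _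
      (fun _ _ => nonneg_of_mem_rowStochastic hP) (sum_row_of_mem_rowStochastic hP a) even_two
  calc π ⬝ᵥ (P *ᵥ f) ^ 2 ≤ π ⬝ᵥ (P *ᵥ f ^ 2) :=
        dotProduct_le_dotProduct_of_nonneg_left hjensen hπ
    _ = π ⬝ᵥ f ^ 2 := by rw [dotProduct_mulVec, hstat]

theorem two_smul_sub_one_mem_rowStochastic (hP : P ∈ rowStochastic ℝ Ω)
    (hlazy : ∀ a, 1 / 2 ≤ P a a) : (2 : ℝ) • P - 1 ∈ rowStochastic ℝ Ω := by
  refine mem_rowStochastic.2 ⟨fun a b => ?_, ?_⟩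
  · rw [Matrix.sub_apply, Matrix.smul_apply, smul_eq_mul]
    rcases eq_or_ne a b with rfl | hab
    · rw [one_apply_eq]
      linarith [hlazy a]
    · rw [one_apply_ne hab]
      linarith [nonneg_of_mem_rowStochastic hP (i := a) (j := b)]
  · rw [sub_mulVec, smul_mulVec, one_mulVec, one_vecMul_of_mem_rowStochastic hP, two_smul,
      add_sub_cancel_right]

/- Laziness makes `2P - 1` a stochastic matrix, hence a contraction of `L²(π)`; expanding the
square of `2Pf - f` turns this into the loss of one full Dirichlet form. -/
theorem variance_mulVec_le (hP : P ∈ rowStochastic ℝ Ω) (hlazy : ∀ a, 1 / 2 ≤ P a a)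
    (hπ : ∀ a, 0 ≤ π a) (hstat : π ᵥ* P = π) (f : Ω → ℝ) :
    variance π (P *ᵥ f) ≤ variance π f - dirichletForm P π f := by
  have hstat' : π ᵥ* ((2 : ℝ) • P - 1) = π := by
    rw [vecMul_sub, vecMul_smul, vecMul_one, hstat, two_smul, add_sub_cancel_right]
  have hcontract :=
    dotProduct_mulVec_sq_le (two_smul_sub_one_mem_rowStochastic hP hlazy) hπ hstat' f
  have hexpand : π ⬝ᵥ (((2 : ℝ) • P - 1) *ᵥ f) ^ 2 =
      4 * π ⬝ᵥ (P *ᵥ f) ^ 2 - 4 * π ⬝ᵥ (f * P *ᵥ f) + π ⬝ᵥ f ^ 2 := by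
    rw [sub_mulVec, smul_mulVec, one_mulVec]
    simp only [dotProduct, Pi.pow_apply, Pi.sub_apply, Pi.smul_apply, Pi.mul_apply, smul_eq_mul,
      Finset.mul_sum, ← Finset.sum_add_distrib, ← Finset.sum_sub_distrib]
    exact Finset.sum_congr rfl fun a _ => by ring
  rw [variance, variance, dotProduct_mulVec, hstat, dirichletForm_eq_sub hP hstat]
  linarith

theorem PoincareInequality.variance_pow_mulVec_le {C : ℝ} (hC : 1 ≤ C)
    (hpoincare : PoincareInequality P π C) (hP : P ∈ rowStochastic ℝ Ω)
    (hlazy : ∀ a, 1 / 2 ≤ P a a) (hπ : ∀ a, 0 ≤ π a) (hstat : π ᵥ* P = π) (f : Ω → ℝ) (t : ℕ) :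
    variance π (P ^ t *ᵥ f) ≤ (1 - 1 / C) ^ t * variance π f := by
  have hrate : 0 ≤ 1 - 1 / C := sub_nonneg.2 (div_le_one_of_le₀ hC (by positivity))
  induction t with
  | zero => simp
  | succ t ih =>
    have hgap : 1 / C * variance π (P ^ t *ᵥ f) ≤ dirichletForm P π (P ^ t *ᵥ f) := by
      rw [one_div, inv_mul_le_iff₀ (by positivity)]
      exact hpoincare _
    calc variance π (P ^ (t + 1) *ᵥ f) = variance π (P *ᵥ (P ^ t *ᵥ f)) := by
          rw [pow_succ', mulVec_mulVec]
      _ ≤ variance π (P ^ t *ᵥ f) - dirichletForm P π (P ^ t *ᵥ f) :=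
          variance_mulVec_le hP hlazy hπ hstat _
      _ ≤ (1 - 1 / C) * variance π (P ^ t *ᵥ f) := by linarith
      _ ≤ (1 - 1 / C) * ((1 - 1 / C) ^ t * variance π f) := mul_le_mul_of_nonneg_left ih hrate
      _ = (1 - 1 / C) ^ (t + 1) * variance π f := by ring

theorem PoincareInequality.worstDist_le [Nonempty Ω] {C p δ : ℝ} (hC : 1 ≤ C)
    (hpoincare : PoincareInequality P π C) (hP : P ∈ rowStochastic ℝ Ω)
    (hlazy : ∀ a, 1 / 2 ≤ P a a) (hπ : π ∈ stdSimplex ℝ Ω) (hstat : π ᵥ* P = π) (hp : 0 < p)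
    (hpπ : ∀ a, p ≤ π a) (hδ : 0 ≤ δ) {t : ℕ} (ht : (1 - 1 / C) ^ t ≤ p * δ ^ 2) :
    worstDist P π t ≤ δ := by
  have hrate : 0 ≤ 1 - 1 / C := sub_nonneg.2 (div_le_one_of_le₀ hC (by positivity))
  refine ciSup_le fun s => ciSup_le fun S => abs_le_of_sq_le_sq (le_of_mul_le_mul_left ?_ hp) hδ
  set f : Ω → ℝ := (S : Set Ω).indicator 1
  set g : Ω → ℝ := P ^ t *ᵥ f
  have hgs : g s = ∑ a ∈ S, (P ^ t) s a := dotProduct_indicator_one _ S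
  have hmean : ∀ t : ℕ, π ⬝ᵥ (P ^ t *ᵥ f) = π ⬝ᵥ f := fun t => by
    induction t with
    | zero => simp
    | succ t ih => rw [pow_succ', ← mulVec_mulVec, dotProduct_mulVec, hstat, ih]
  calc p * (∑ a ∈ S, (P ^ t) s a - ∑ a ∈ S, π a) ^ 2 = p * (g s - π ⬝ᵥ g) ^ 2 := by
        rw [hgs, hmean, dotProduct_indicator_one]
    _ ≤ π s * (g s - π ⬝ᵥ g) ^ 2 := mul_le_mul_of_nonneg_right (hpπ s) (sq_nonneg _)
    _ ≤ ∑ a, π a * (g a - π ⬝ᵥ g) ^ 2 :=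
        Finset.single_le_sum (f := fun a => π a * (g a - π ⬝ᵥ g) ^ 2)
          (fun a _ => mul_nonneg (hπ.1 a) (sq_nonneg _)) (Finset.mem_univ s)
    _ = variance π g := by rw [dotProduct_sub_const_sq hπ, sub_self, sq, mul_zero, add_zero]
    _ ≤ (1 - 1 / C) ^ t * variance π f :=
        hpoincare.variance_pow_mulVec_le hC hP hlazy hπ.1 hstat f t
    _ ≤ (1 - 1 / C) ^ t :=
        mul_le_of_le_one_right (pow_nonneg hrate t) (variance_indicator_le_one π S)
    _ ≤ p * δ ^ 2 := ht

theorem one_sub_inv_pow_le_of_mul_neg_log_le {C q : ℝ} (hC : 1 ≤ C) (hq : 0 < q) {t : ℕ}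
    (ht : C * -Real.log q ≤ t) : (1 - 1 / C) ^ t ≤ q := by
  have hC₀ : 0 < C := by linarith
  have hlog : -Real.log q ≤ t / C := by
    rwa [le_div_iff₀' hC₀]
  calc (1 - 1 / C) ^ t ≤ Real.exp (-(1 / C)) ^ t :=
        pow_le_pow_left₀ (sub_nonneg.2 (div_le_one_of_le₀ hC hC₀.le)) (Real.one_sub_le_exp_neg _) t
    _ = Real.exp (-(t / C)) := by
        rw [← Real.exp_nat_mul]
        ring_nf
    _ ≤ q := by
        rw [← Real.le_log_iff_exp_le hq]
        linarith

theorem exists_isMixingTime_le_of_worstDist_le {δ : ℝ} {t : ℕ} (h : worstDist P π t ≤ δ) :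
    ∃ s, IsMixingTime P π δ s ∧ s ≤ t := by
  obtain ⟨s, hs⟩ : ∃ s, IsMixingTime P π δ s :=
    ⟨_, Nat.sInf_mem ⟨t, h⟩, fun _ => Nat.sInf_le⟩
  exact ⟨s, hs, hs.2 h⟩

theorem PoincareInequality.exists_isMixingTime_le [Nonempty Ω] {C p δ : ℝ} (hC : 1 ≤ C)
    (hpoincare : PoincareInequality P π C) (hP : P ∈ rowStochastic ℝ Ω)
    (hlazy : ∀ a, 1 / 2 ≤ P a a) (hπ : π ∈ stdSimplex ℝ Ω) (hstat : π ᵥ* P = π) (hp : 0 < p)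
    (hpπ : ∀ a, p ≤ π a) (hδ : 0 < δ) :
    ∃ t, IsMixingTime P π δ t ∧ t ≤ ⌈C * (-Real.log p - 2 * Real.log δ)⌉₊ := by
  refine exists_isMixingTime_le_of_worstDist_le <|
    hpoincare.worstDist_le hC hP hlazy hπ hstat hp hpπ hδ.le <|
    one_sub_inv_pow_le_of_mul_neg_log_le hC (by positivity) <|
    (le_of_eq ?_).trans (Nat.le_ceil _)
  rw [Real.log_mul hp.ne' (by positivity), Real.log_pow]
  push_cast
  ring

end MarkovMixing

namespace Worm

open Finset MarkovMixing
open scoped BigOperators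

section SymmDiff

variable {α : Type*} [DecidableEq α]

theorem card_symmDiff_add_two_mul_card_inter (s t : Finset α) :
    #(s ∆ t) + 2 * #(s ∩ t) = #s + #t := by
  have hs := card_sdiff_add_card_inter s t
  have ht := card_sdiff_add_card_inter t s
  rw [inter_comm] at ht
  rw [symmDiff_def, sup_eq_union, card_union_of_disjoint disjoint_sdiff_sdiff]
  lia

theorem odd_card_symmDiff (s t : Finset α) : Odd #(s ∆ t) ↔ Xor (Odd #s) (Odd #t) := by
  have := card_symmDiff_add_two_mul_card_inter s t
  grind

theorem card_symmDiff_pair {u v : α} (huv : u ≠ v) (T : Finset α) :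
    #(T ∆ {u, v}) + ((if u ∈ T then 2 else 0) + if v ∈ T then 2 else 0) = #T + 2 := by
  have hcard := card_symmDiff_add_two_mul_card_inter T {u, v}
  rw [card_pair huv, inter_comm] at hcard
  have hinter : 2 * #({u, v} ∩ T) = (if u ∈ T then 2 else 0) + if v ∈ T then 2 else 0 := by
    rw [← filter_mem_eq_inter, card_filter, sum_pair huv]
    split_ifs <;> rfl
  lia

theorem symmDiff_singleton_of_mem {s : Finset α} {a : α} (ha : a ∈ s) : s ∆ {a} = s.erase a := by
  ext b
  by_cases h : b = a <;> simp [mem_symmDiff, ha, h]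

theorem symmDiff_singleton_of_notMem {s : Finset α} {a : α} (ha : a ∉ s) :
    s ∆ {a} = insert a s := by
  ext b
  by_cases h : b = a <;> simp [mem_symmDiff, ha, h]

theorem card_add_card_symmDiff {F D S : Finset α} (hS : S ⊆ D) :
    #F + #(F ∆ D) = #(F ∆ S) + #((F ∆ S) ∆ D) := by
  have hFD := card_symmDiff_add_two_mul_card_inter F D
  have hFS := card_symmDiff_add_two_mul_card_inter F S
  have hFSD := card_symmDiff_add_two_mul_card_inter (F ∆ S) D
  have hinter : (F ∆ S) ∩ D = (F ∩ D) ∆ S := by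
    conv_rhs => rw [← inter_eq_left.2 hS]
    exact inf_symmDiff_distrib_right F S D
  have hcard := card_symmDiff_add_two_mul_card_inter (F ∩ D) S
  rw [inter_assoc, inter_eq_right.2 hS, ← hinter] at hcard
  lia

end SymmDiff

section Boundary

variable {V : Type*} [Fintype V] [DecidableEq V]

theorem mem_boundary {A : Finset (Sym2 V)} {v : V} :
    v ∈ boundary A ↔ Odd #{e ∈ A | v ∈ e} := by
  simp [boundary]

theorem boundary_symmDiff (A B : Finset (Sym2 V)) :
    boundary (A ∆ B) = boundary A ∆ boundary B := by
  ext v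
  have hfilter : {e ∈ A ∆ B | v ∈ e} = {e ∈ A | v ∈ e} ∆ {e ∈ B | v ∈ e} := by
    ext e
    simp only [mem_filter, mem_symmDiff]
    tauto
  rw [mem_symmDiff, mem_boundary, mem_boundary, mem_boundary, hfilter, odd_card_symmDiff, Xor]

@[simp]
theorem boundary_empty : boundary (∅ : Finset (Sym2 V)) = ∅ := by
  ext v
  simp [mem_boundary]

theorem boundary_flip (A : Finset (Sym2 V)) (u v : V) :
    boundary (A ∆ {s(u, v)}) = boundary A ∆ {u, v} := by
  have hsingle : boundary {s(u, v)} = {u, v} := by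
    ext w
    rw [mem_boundary, filter_singleton]
    split_ifs with hw <;> simpa using hw
  rw [boundary_symmDiff, hsingle]

end Boundary

section Configurations

variable {V : Type*} [Fintype V] [DecidableEq V] (G : SimpleGraph V) [DecidableRel G.Adj]

/-- The configuration space `W = C_0 ∪ C_2` underlying `State`, as a finite set. -/
abbrev worm : Finset (Finset (Sym2 V)) :=
  config G 0 ∪ config G 2

variable {G}

theorem mem_config {k : ℕ} {A : Finset (Sym2 V)} :
    A ∈ config G k ↔ A ⊆ G.edgeFinset ∧ #(boundary A) = k := by
  simp [config]

theorem mem_config_zero {A : Finset (Sym2 V)} :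
    A ∈ config G 0 ↔ A ⊆ G.edgeFinset ∧ boundary A = ∅ := by
  rw [mem_config, card_eq_zero]

theorem mem_worm {A : Finset (Sym2 V)} :
    A ∈ worm G ↔ A ⊆ G.edgeFinset ∧ (#(boundary A) = 0 ∨ #(boundary A) = 2) := by
  rw [mem_union, mem_config, mem_config, and_or_left]

theorem notMem_config_zero {A : Finset (Sym2 V)} (hA : A ∈ config G 2) : A ∉ config G 0 :=
  fun hA₀ => absurd ((mem_config.1 hA₀).2.symm.trans (mem_config.1 hA).2) (by decide)

theorem empty_mem_config_zero : ∅ ∈ config G 0 :=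
  mem_config_zero.2 ⟨empty_subset _, boundary_empty⟩

theorem symmDiff_subset_edgeFinset {A B : Finset (Sym2 V)} (hA : A ⊆ G.edgeFinset)
    (hB : B ⊆ G.edgeFinset) : A ∆ B ⊆ G.edgeFinset :=
  symmDiff_subset_union.trans (union_subset hA hB)

theorem flip_subset_edgeFinset {A : Finset (Sym2 V)} (hA : A ⊆ G.edgeFinset) {u v : V}
    (huv : G.Adj u v) : A ∆ {s(u, v)} ⊆ G.edgeFinset :=
  symmDiff_subset_edgeFinset hA (singleton_subset_iff.2 (SimpleGraph.mem_edgeFinset.2 huv))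

theorem symmDiff_mem_worm {F D : Finset (Sym2 V)} (hF : F ∈ config G 0) (hD : D ∈ worm G) :
    F ∆ D ∈ worm G := by
  obtain ⟨hFE, hF⟩ := mem_config_zero.1 hF
  obtain ⟨hDE, hD⟩ := mem_worm.1 hD
  refine mem_worm.2 ⟨symmDiff_subset_edgeFinset hFE hDE, ?_⟩
  rwa [boundary_symmDiff, hF, ← bot_eq_empty, bot_symmDiff]

theorem startSet_of_zero {A : Finset (Sym2 V)} (hA : A ∈ config G 0) : startSet G A = univ :=
  if_pos hA

theorem startSet_of_two {A : Finset (Sym2 V)} (hA : A ∈ config G 2) : startSet G A = boundary A :=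
  if_neg (notMem_config_zero hA)

theorem flip_mem_worm {A : Finset (Sym2 V)} (hA : A ∈ worm G) {u v : V} (huv : G.Adj u v)
    (hu : u ∈ startSet G A) : A ∆ {s(u, v)} ∈ worm G := by
  refine mem_worm.2 ⟨flip_subset_edgeFinset (mem_worm.1 hA).1 huv, ?_⟩
  have hcard := card_symmDiff_pair huv.ne (boundary A)
  rw [boundary_flip]
  rcases mem_union.1 hA with hA | hA
  · rw [(mem_config_zero.1 hA).2, ← bot_eq_empty, bot_symmDiff, card_pair huv.ne]
    exact Or.inr rfl
  · rw [startSet_of_two hA] at hu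
    rw [(mem_config.1 hA).2, if_pos hu] at hcard
    split_ifs at hcard <;> lia

theorem exists_erase_mem_worm {D : Finset (Sym2 V)} (hD : D ∈ worm G) (hne : D.Nonempty) :
    ∃ e ∈ D, D.erase e ∈ worm G := by
  obtain ⟨u, hu, e, he, hue⟩ : ∃ u ∈ startSet G D, ∃ e ∈ D, u ∈ e := by
    rcases mem_union.1 hD with hD | hD
    · obtain ⟨e, he⟩ := hne
      exact ⟨e.out.1, startSet_of_zero hD ▸ mem_univ _, e, he, e.out_fst_mem⟩
    · obtain ⟨u, hu⟩ : (boundary D).Nonempty := card_pos.1 ((mem_config.1 hD).2 ▸ two_pos)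
      obtain ⟨e, he⟩ := card_pos.1 (mem_boundary.1 hu).pos
      exact ⟨u, startSet_of_two hD ▸ hu, e, mem_filter.1 he⟩
  obtain ⟨v, rfl⟩ := hue
  have huv : G.Adj u v := SimpleGraph.mem_edgeFinset.1 ((mem_worm.1 hD).1 he)
  exact ⟨_, he, symmDiff_singleton_of_mem he ▸ flip_mem_worm hD huv hu⟩

/- The edges of `D` are removed one at a time, and `S e` is what is left of `D` just before the
removal of `e`. -/
theorem exists_peeling {D : Finset (Sym2 V)} (hD : D ∈ worm G) :
    ∃ S : Sym2 V → Finset (Sym2 V),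
      (∀ e ∈ D, S e ⊆ D ∧ S e ∈ worm G ∧ S e ∆ {e} ∈ worm G) ∧
      ∀ h : Finset (Sym2 V) → ℝ, h D - h ∅ = ∑ e ∈ D, (h (S e) - h (S e ∆ {e})) := by
  induction D using Finset.strongInduction with
  | H D ih =>
    obtain rfl | hne := D.eq_empty_or_nonempty
    · exact ⟨fun _ => ∅, by simp⟩
    obtain ⟨e, he, hDe⟩ := exists_erase_mem_worm hD hne
    obtain ⟨S, hS, hsum⟩ := ih _ (erase_ssubset he) hDe
    have hupdate : ∀ a ∈ D.erase e, Function.update S e D a = S a := fun a ha =>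
      Function.update_of_ne (ne_of_mem_erase ha) _ _
    refine ⟨Function.update S e D, fun a ha => ?_, fun h => ?_⟩
    · obtain rfl | hae := eq_or_ne a e
      · rw [Function.update_self, symmDiff_singleton_of_mem ha]
        exact ⟨subset_rfl, hD, hDe⟩
      · have hae' := mem_erase.2 ⟨hae, ha⟩
        rw [hupdate a hae']
        exact ⟨(hS a hae').1.trans (erase_subset _ _), (hS a hae').2⟩
    · rw [← add_sum_erase D _ he, Function.update_self, symmDiff_singleton_of_mem he,
        sum_congr rfl fun a ha => by rw [hupdate a ha], ← hsum h]
      ring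

end Configurations

section HighTemperature

variable {V : Type*}

/-- The product `σ_T = ∏ v ∈ T, σ v` of the Ising spins `σ v = ±1` over a set of vertices. -/
def spinProd (σ : V → ℤˣ) (T : Finset V) : ℤˣ :=
  ∏ v ∈ T, σ v

theorem spin_cast_le_one (s : ℤˣ) : ((s : ℤ) : ℝ) ≤ 1 := by
  obtain rfl | rfl := Int.units_eq_one_or s <;> norm_num

theorem one_add_mul_spin_nonneg {x : ℝ} (hx : x ∈ Set.Icc (0 : ℝ) 1) (s : ℤˣ) :
    0 ≤ 1 + x * ((s : ℤ) : ℝ) := by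
  obtain rfl | rfl := Int.units_eq_one_or s <;> push_cast <;> linarith [hx.1, hx.2]

variable [Fintype V] [DecidableEq V]

theorem prod_spinProd_toFinset (σ : V → ℤˣ) (B : Finset (Sym2 V)) :
    ∏ e ∈ B, spinProd σ e.toFinset = spinProd σ (boundary B) := by
  have hswap : ∏ e ∈ B, spinProd σ e.toFinset = ∏ v, σ v ^ #{e ∈ B | v ∈ e} := by
    simp only [spinProd, ← prod_const]
    exact prod_comm' fun e v => by simp
  rw [hswap, spinProd, boundary, prod_filter]
  refine prod_congr rfl fun v _ => ?_
  rw [Int.units_pow_eq_pow_mod_two]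
  split_ifs with hv
  · rw [Nat.odd_iff.1 hv, pow_one]
  · rw [Nat.not_odd_iff.1 hv, pow_zero]

theorem sum_spinProd_mul_spinProd (T U : Finset V) :
    ∑ σ : V → ℤˣ, ((spinProd σ T : ℤ) : ℝ) * ((spinProd σ U : ℤ) : ℝ) =
      if T = U then 2 ^ Fintype.card V else 0 := by
  set f : V → ℤˣ → ℝ := fun v s =>
    (if v ∈ T then ((s : ℤ) : ℝ) else 1) * if v ∈ U then ((s : ℤ) : ℝ) else 1
  have hfactor : ∑ σ : V → ℤˣ, ((spinProd σ T : ℤ) : ℝ) * ((spinProd σ U : ℤ) : ℝ) =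
      ∏ v, ∑ s, f v s := by
    rw [prod_univ_sum, Fintype.piFinset_univ]
    refine sum_congr rfl fun σ _ => ?_
    simp only [f, prod_mul_distrib, prod_ite_mem, univ_inter, spinProd]
    push_cast
    rfl
  have hsum : ∀ v, ∑ s, f v s = if v ∈ T ↔ v ∈ U then 2 else 0 := fun v => by
    rw [UnitsInt.univ, sum_pair (by decide)]
    by_cases hT : v ∈ T <;> by_cases hU : v ∈ U <;> norm_num [f, hT, hU]
  rw [hfactor, prod_congr rfl fun v _ => hsum v]
  split_ifs with hTU
  · simp [hTU]
  · obtain ⟨v, hv⟩ := not_forall.1 (mt Finset.ext hTU)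
    exact prod_eq_zero (mem_univ v) (if_neg hv)

theorem sum_spinProd_mul_prod (E : Finset (Sym2 V)) (x : ℝ) (T : Finset V) :
    ∑ σ : V → ℤˣ, ((spinProd σ T : ℤ) : ℝ) *
        ∏ e ∈ E, (1 + x * ((spinProd σ e.toFinset : ℤ) : ℝ)) =
      2 ^ Fintype.card V * ∑ B ∈ E.powerset with boundary B = T, x ^ #B := by
  have hexpand : ∀ σ : V → ℤˣ, ((spinProd σ T : ℤ) : ℝ) *
      ∏ e ∈ E, (1 + x * ((spinProd σ e.toFinset : ℤ) : ℝ)) =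
      ∑ B ∈ E.powerset, x ^ #B *
        (((spinProd σ (boundary B) : ℤ) : ℝ) * ((spinProd σ T : ℤ) : ℝ)) := fun σ => by
    rw [prod_one_add, mul_sum]
    refine sum_congr rfl fun B _ => ?_
    rw [prod_mul_distrib, prod_const, ← prod_spinProd_toFinset]
    push_cast
    ring
  simp only [hexpand]
  rw [sum_comm, sum_filter, mul_sum]
  refine sum_congr rfl fun B _ => ?_
  rw [← mul_sum, sum_spinProd_mul_spinProd]
  split_ifs <;> ring

/- By the high-temperature expansion this says that the spin correlation of `T` in the Ising model
on `E` is at most `1`. -/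
theorem sum_boundary_eq_le (E : Finset (Sym2 V)) {x : ℝ} (hx : x ∈ Set.Icc (0 : ℝ) 1)
    (T : Finset V) : ∑ B ∈ E.powerset with boundary B = T, x ^ #B ≤
      ∑ B ∈ E.powerset with boundary B = ∅, x ^ #B := by
  refine le_of_mul_le_mul_left ?_ (pow_pos (two_pos (α := ℝ)) (Fintype.card V))
  rw [← sum_spinProd_mul_prod, ← sum_spinProd_mul_prod]
  refine sum_le_sum fun σ _ => mul_le_mul_of_nonneg_right ?_
    (prod_nonneg fun e _ => one_add_mul_spin_nonneg hx _)
  simpa [spinProd] using spin_cast_le_one (spinProd σ T)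

end HighTemperature

section Congestion

variable {V : Type*} [Fintype V] [DecidableEq V] {G : SimpleGraph V} [DecidableRel G.Adj]

theorem card_powersetCard_zero_union_two_le (ι : Type*) [Fintype ι] [DecidableEq ι] [Nonempty ι] :
    #(powersetCard 0 univ ∪ powersetCard 2 (univ : Finset ι)) ≤ Fintype.card ι ^ 2 := by
  refine (card_union_le _ _).trans ?_
  rw [card_powersetCard, card_powersetCard, card_univ, Nat.choose_zero_right, Nat.choose_two_right]
  have := Nat.div_mul_le_self (Fintype.card ι * (Fintype.card ι - 1)) 2
  obtain ⟨k, hk⟩ := Nat.exists_eq_add_one_of_ne_zero (Fintype.card_ne_zero (α := ι))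
  rw [hk, Nat.add_sub_cancel] at this ⊢
  nlinarith

theorem sum_worm_fiber_symmDiff_le {x : ℝ} (hx : x ∈ Set.Icc (0 : ℝ) 1) {A : Finset (Sym2 V)}
    (hA : A ⊆ G.edgeFinset) (T : Finset V) :
    ∑ D ∈ worm G with boundary D = T, x ^ #(A ∆ D) ≤ ∑ B ∈ config G 0, x ^ #B := by
  have hconfig : config G 0 = {B ∈ G.edgeFinset.powerset | boundary B = ∅} := by
    ext B
    rw [mem_config_zero, mem_filter, mem_powerset]
  rw [hconfig]
  refine le_trans ?_ (sum_boundary_eq_le G.edgeFinset hx (boundary A ∆ T))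
  rw [← sum_image (f := fun B : Finset (Sym2 V) => x ^ #B) (symmDiff_right_injective A).injOn]
  refine sum_le_sum_of_subset_of_nonneg (image_subset_iff.2 fun D hD => ?_)
    fun _ _ _ => pow_nonneg hx.1 _
  obtain ⟨hDW, rfl⟩ := mem_filter.1 hD
  exact mem_filter.2 ⟨mem_powerset.2 (symmDiff_subset_edgeFinset hA (mem_worm.1 hDW).1),
    boundary_symmDiff A D⟩

theorem sum_worm_symmDiff_le [Nonempty V] {x : ℝ} (hx : x ∈ Set.Icc (0 : ℝ) 1)
    {A : Finset (Sym2 V)} (hA : A ⊆ G.edgeFinset) :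
    ∑ D ∈ worm G, x ^ #(A ∆ D) ≤ (Fintype.card V : ℝ) ^ 2 * ∑ B ∈ config G 0, x ^ #B := by
  set 𝒯 : Finset (Finset V) := powersetCard 0 univ ∪ powersetCard 2 univ
  have hboundary : ∀ D ∈ worm G, boundary D ∈ 𝒯 := fun D hD => by
    simpa [𝒯, mem_powersetCard] using (mem_worm.1 hD).2
  have hcard : (#𝒯 : ℝ) ≤ (Fintype.card V : ℝ) ^ 2 :=
    mod_cast card_powersetCard_zero_union_two_le V
  calc ∑ D ∈ worm G, x ^ #(A ∆ D)
      = ∑ T ∈ 𝒯, ∑ D ∈ worm G with boundary D = T, x ^ #(A ∆ D) :=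
        (sum_fiberwise_of_maps_to hboundary _).symm
    _ ≤ #𝒯 • ∑ B ∈ config G 0, x ^ #B :=
        sum_le_card_nsmul _ _ _ fun T _ => sum_worm_fiber_symmDiff_le hx hA T
    _ ≤ (Fintype.card V : ℝ) ^ 2 * ∑ B ∈ config G 0, x ^ #B := by
        rw [nsmul_eq_mul]
        exact mul_le_mul_of_nonneg_right hcard (sum_nonneg fun _ _ => pow_nonneg hx.1 _)

end Congestion

section CanonicalPaths

variable {V : Type*} [Fintype V] [DecidableEq V] (G : SimpleGraph V) [DecidableRel G.Adj]

/-- The contribution of the flip of `e` at `A` to the energy of `g`, counted as zero when the flip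
leaves the configuration space. -/
def flipEnergy (x : ℝ) (g : Finset (Sym2 V) → ℝ) (A : Finset (Sym2 V)) (e : Sym2 V) : ℝ :=
  if A ∆ {e} ∈ worm G then x ^ #A * (g A - g (A ∆ {e})) ^ 2 else 0

variable {G} {x : ℝ}

theorem flipEnergy_nonneg (hx : 0 ≤ x) (g : Finset (Sym2 V) → ℝ) (A : Finset (Sym2 V))
    (e : Sym2 V) : 0 ≤ flipEnergy G x g A e := by
  rw [flipEnergy]
  split_ifs <;> positivity

/- The canonical path from `F` to `F ∆ D` runs through the configurations `F ∆ S e`. -/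
theorem exists_path_energy_le (hx : 0 ≤ x) (g : Finset (Sym2 V) → ℝ) {D : Finset (Sym2 V)}
    (hD : D ∈ worm G) :
    ∃ S : Sym2 V → Finset (Sym2 V), (∀ e ∈ D, S e ∈ worm G) ∧
      ∀ F ∈ config G 0, x ^ #(F ∆ D) * x ^ #F * (g (F ∆ D) - g F) ^ 2 ≤
        #D * ∑ e ∈ D, x ^ #((F ∆ S e) ∆ D) * flipEnergy G x g (F ∆ S e) e := by
  obtain ⟨S, hS, hsum⟩ := exists_peeling hD
  refine ⟨S, fun e he => (hS e he).2.1, fun F hF => ?_⟩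
  have htelescope : g (F ∆ D) - g F = ∑ e ∈ D, (g (F ∆ S e) - g (F ∆ S e ∆ {e})) := by
    simpa only [← bot_eq_empty, symmDiff_bot, symmDiff_assoc] using hsum fun X => g (F ∆ X)
  have hterm : ∀ e ∈ D, x ^ #(F ∆ D) * x ^ #F * (g (F ∆ S e) - g (F ∆ S e ∆ {e})) ^ 2 =
      x ^ #((F ∆ S e) ∆ D) * flipEnergy G x g (F ∆ S e) e := fun e he => by
    have hflip : F ∆ S e ∆ {e} ∈ worm G :=
      symmDiff_assoc F _ _ ▸ symmDiff_mem_worm hF (hS e he).2.2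
    rw [flipEnergy, if_pos hflip, ← pow_add, add_comm, card_add_card_symmDiff (hS e he).1, pow_add]
    ring
  calc x ^ #(F ∆ D) * x ^ #F * (g (F ∆ D) - g F) ^ 2
      ≤ x ^ #(F ∆ D) * x ^ #F * (#D * ∑ e ∈ D, (g (F ∆ S e) - g (F ∆ S e ∆ {e})) ^ 2) := by
        rw [htelescope]
        exact mul_le_mul_of_nonneg_left sq_sum_le_card_mul_sum_sq (by positivity)
    _ = #D * ∑ e ∈ D, x ^ #((F ∆ S e) ∆ D) * flipEnergy G x g (F ∆ S e) e := by
        rw [mul_left_comm, mul_sum, sum_congr rfl hterm]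

theorem sum_config_zero_sq_sub_le (hx : 0 ≤ x) (g : Finset (Sym2 V) → ℝ) {D : Finset (Sym2 V)}
    (hD : D ∈ worm G) :
    ∑ F ∈ config G 0, x ^ #(F ∆ D) * x ^ #F * (g (F ∆ D) - g F) ^ 2 ≤
      #G.edgeFinset * ∑ A ∈ worm G, ∑ e ∈ G.edgeFinset, flipEnergy G x g A e * x ^ #(A ∆ D) := by
  obtain ⟨S, hSW, hS⟩ := exists_path_energy_le hx g hD
  have hDE : D ⊆ G.edgeFinset := (mem_worm.1 hD).1
  have hnonneg : ∀ A e, 0 ≤ x ^ #(A ∆ D) * flipEnergy G x g A e := fun A e =>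
    mul_nonneg (pow_nonneg hx _) (flipEnergy_nonneg hx g A e)
  -- For fixed `D` and `e` a path is determined by any configuration `F ∆ S e` it visits.
  have hinj : ∀ e ∈ D, ∑ F ∈ config G 0, x ^ #((F ∆ S e) ∆ D) * flipEnergy G x g (F ∆ S e) e ≤
      ∑ A ∈ worm G, x ^ #(A ∆ D) * flipEnergy G x g A e := fun e he => by
    rw [← sum_image (f := fun A => x ^ #(A ∆ D) * flipEnergy G x g A e)
      (symmDiff_left_injective (S e)).injOn]
    exact sum_le_sum_of_subset_of_nonneg
      (image_subset_iff.2 fun F hF => symmDiff_mem_worm hF (hSW e he)) fun A _ _ => hnonneg A e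
  calc ∑ F ∈ config G 0, x ^ #(F ∆ D) * x ^ #F * (g (F ∆ D) - g F) ^ 2
      ≤ ∑ F ∈ config G 0, #D * ∑ e ∈ D, x ^ #((F ∆ S e) ∆ D) * flipEnergy G x g (F ∆ S e) e :=
        sum_le_sum hS
    _ = #D * ∑ e ∈ D, ∑ F ∈ config G 0, x ^ #((F ∆ S e) ∆ D) * flipEnergy G x g (F ∆ S e) e := by
        rw [← mul_sum, sum_comm]
    _ ≤ #G.edgeFinset * ∑ e ∈ G.edgeFinset, ∑ A ∈ worm G, x ^ #(A ∆ D) * flipEnergy G x g A e := by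
        refine mul_le_mul (mod_cast card_le_card hDE) ((sum_le_sum hinj).trans ?_)
          (sum_nonneg fun e _ => sum_nonneg fun F _ => hnonneg _ e) (Nat.cast_nonneg _)
        exact sum_le_sum_of_subset_of_nonneg hDE fun e _ _ => sum_nonneg fun A _ => hnonneg A e
    _ = #G.edgeFinset * ∑ A ∈ worm G, ∑ e ∈ G.edgeFinset, flipEnergy G x g A e * x ^ #(A ∆ D) := by
        rw [sum_comm]
        simp only [mul_comm]

theorem sum_worm_sq_sub_le [Nonempty V] (hx : x ∈ Set.Icc (0 : ℝ) 1) (g : Finset (Sym2 V) → ℝ) :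
    ∑ F ∈ config G 0, ∑ I ∈ worm G, x ^ #I * x ^ #F * (g I - g F) ^ 2 ≤
      #G.edgeFinset * (Fintype.card V : ℝ) ^ 2 * (∑ B ∈ config G 0, x ^ #B) *
        ∑ A ∈ worm G, ∑ e ∈ G.edgeFinset, flipEnergy G x g A e := by
  calc ∑ F ∈ config G 0, ∑ I ∈ worm G, x ^ #I * x ^ #F * (g I - g F) ^ 2
      = ∑ F ∈ config G 0, ∑ D ∈ worm G, x ^ #(F ∆ D) * x ^ #F * (g (F ∆ D) - g F) ^ 2 :=
        sum_congr rfl fun F hF => sum_nbij' (F ∆ ·) (F ∆ ·)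
          (fun _ => symmDiff_mem_worm hF) (fun _ => symmDiff_mem_worm hF)
          (fun _ _ => symmDiff_symmDiff_cancel_left F _)
          (fun _ _ => symmDiff_symmDiff_cancel_left F _)
          fun I _ => by rw [symmDiff_symmDiff_cancel_left]
    _ ≤ ∑ D ∈ worm G, #G.edgeFinset *
          ∑ A ∈ worm G, ∑ e ∈ G.edgeFinset, flipEnergy G x g A e * x ^ #(A ∆ D) := by
        rw [sum_comm]
        exact sum_le_sum fun D hD => sum_config_zero_sq_sub_le hx.1 g hD
    _ = #G.edgeFinset * ∑ A ∈ worm G,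
          (∑ e ∈ G.edgeFinset, flipEnergy G x g A e) * ∑ D ∈ worm G, x ^ #(A ∆ D) := by
        rw [← mul_sum, sum_comm]
        simp only [← sum_mul, ← mul_sum]
    _ ≤ #G.edgeFinset * ∑ A ∈ worm G, (∑ e ∈ G.edgeFinset, flipEnergy G x g A e) *
          ((Fintype.card V : ℝ) ^ 2 * ∑ B ∈ config G 0, x ^ #B) :=
        mul_le_mul_of_nonneg_left (sum_le_sum fun A hA => mul_le_mul_of_nonneg_left
          (sum_worm_symmDiff_le hx (mem_worm.1 hA).1)
          (sum_nonneg fun e _ => flipEnergy_nonneg hx.1 g A e)) (Nat.cast_nonneg _)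
    _ = #G.edgeFinset * (Fintype.card V : ℝ) ^ 2 * (∑ B ∈ config G 0, x ^ #B) *
          ∑ A ∈ worm G, ∑ e ∈ G.edgeFinset, flipEnergy G x g A e := by
        rw [← sum_mul]
        ring

end CanonicalPaths

section FlipFactor

variable {V : Type*} [DecidableEq V] {x : ℝ}

theorem flipFactor_nonneg (hx : 0 ≤ x) (A : Finset (Sym2 V)) (e : Sym2 V) :
    0 ≤ flipFactor x A e := by
  rw [flipFactor]
  split_ifs <;> positivity

theorem pow_card_mul_flipFactor (hx : x ≠ 0) (A : Finset (Sym2 V)) (e : Sym2 V) :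
    x ^ #A * flipFactor x A e = x ^ #(A ∆ {e}) := by
  rw [flipFactor]
  split_ifs with he
  · rw [symmDiff_singleton_of_mem he, ← card_erase_add_one he, pow_succ, mul_inv_cancel_right₀ hx]
  · rw [symmDiff_singleton_of_notMem he, card_insert_of_notMem he, pow_succ]

theorem mul_pow_card_le_pow_card_flip (hx : x ∈ Set.Ioc (0 : ℝ) 1) (A : Finset (Sym2 V))
    (e : Sym2 V) : x * x ^ #A ≤ x ^ #(A ∆ {e}) := by
  rw [← pow_card_mul_flipFactor hx.1.ne', mul_comm]
  refine mul_le_mul_of_nonneg_left ?_ (pow_nonneg hx.1.le _)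
  rw [flipFactor]
  split_ifs
  · exact hx.2.trans (one_le_inv_iff₀.2 hx)
  · exact le_rfl

end FlipFactor

section Flow

variable {V : Type*} [Fintype V] [DecidableEq V] (G : SimpleGraph V) [DecidableRel G.Adj]

/-- The unnormalized stationary flow out of `A` through the flip of `uv` when `u` is the vertex
drawn first. -/
noncomputable def flow (x : ℝ) (A : Finset (Sym2 V)) (u v : V) : ℝ :=
  if u ∈ startSet G A then x ^ #A * (accept G x A u v / G.degree u) else 0

variable {G} {x : ℝ} {A : Finset (Sym2 V)} {u v : V}

theorem mem_startSet_of_flip_mem_config_zero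
    (h : A ∈ config G 0 ∨ A ∆ {s(u, v)} ∈ config G 0) {w : V} (hw : w ∈ s(u, v)) :
    w ∈ startSet G A := by
  rw [startSet]
  split_ifs with hA
  · exact mem_univ w
  · have hboundary := (mem_config_zero.1 (h.resolve_left hA)).2
    rw [boundary_flip, ← bot_eq_empty, symmDiff_eq_bot] at hboundary
    rw [hboundary]
    simpa using hw

theorem flow_of_config_zero (hx : 0 < x) (h : A ∈ config G 0 ∨ A ∆ {s(u, v)} ∈ config G 0) :
    flow G x A u v = 1 / 2 * (min (x ^ #A) (x ^ #(A ∆ {s(u, v)})) / G.degree u) := by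
  have hnot : ¬(A ∈ config G 2 ∧ A ∆ {s(u, v)} ∈ config G 2 ∧ u ∈ boundary A) := fun h₂ =>
    h.elim (notMem_config_zero h₂.1) (notMem_config_zero h₂.2.1)
  rw [flow, if_pos (mem_startSet_of_flip_mem_config_zero h (Sym2.mem_mk_left u v)), accept,
    if_neg hnot, ← pow_card_mul_flipFactor hx.ne']
  nth_rewrite 2 [← mul_one (x ^ #A)]
  rw [← mul_min_of_nonneg _ _ (pow_nonneg hx.le #A)]
  ring

theorem flow_of_config_two (hx : 0 < x) (hA : A ∈ config G 2)
    (hflip : A ∆ {s(u, v)} ∈ config G 2) (hdeg : 0 < G.degree u) (hu : u ∈ boundary A) :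
    flow G x A u v =
      1 / 2 * min (x ^ #A / G.degree u) (x ^ #(A ∆ {s(u, v)}) / G.degree v) := by
  have hdeg' : (G.degree u : ℝ) ≠ 0 := Nat.cast_ne_zero.2 hdeg.ne'
  rw [flow, startSet_of_two hA, if_pos hu, accept, if_pos ⟨hA, hflip, hu⟩]
  calc x ^ #A * (1 / 2 * min 1 ((G.degree u : ℝ) / G.degree v * flipFactor x A s(u, v)) /
        G.degree u)
      = 1 / 2 * (x ^ #A / G.degree u *
          min 1 ((G.degree u : ℝ) / G.degree v * flipFactor x A s(u, v))) := by ring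
    _ = 1 / 2 * min (x ^ #A / G.degree u) (x ^ #(A ∆ {s(u, v)}) / G.degree v) := by
        rw [mul_min_of_nonneg _ _ (by positivity), mul_one, ← pow_card_mul_flipFactor hx.ne']
        field_simp

theorem flow_of_notMem_boundary (hA : A ∈ config G 2) (hu : u ∉ boundary A) :
    flow G x A u v = 0 := by
  rw [flow, startSet_of_two hA, if_neg hu]

theorem mem_boundary_or_mem_boundary (huv : u ≠ v) (hA : A ∈ config G 2)
    (hflip : A ∆ {s(u, v)} ∈ config G 2) :
    (u ∈ boundary A ∧ v ∉ boundary A) ∨ (v ∈ boundary A ∧ u ∉ boundary A) := by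
  have hcard := card_symmDiff_pair huv (boundary A)
  rw [← boundary_flip, (mem_config.1 hA).2, (mem_config.1 hflip).2] at hcard
  split_ifs at hcard <;> simp_all

theorem flow_add_flow_of_config_zero (hx : 0 < x)
    (h : A ∈ config G 0 ∨ A ∆ {s(u, v)} ∈ config G 0) :
    flow G x A u v + flow G x A v u = 1 / 2 * (min (x ^ #A) (x ^ #(A ∆ {s(u, v)})) / G.degree u) +
      1 / 2 * (min (x ^ #A) (x ^ #(A ∆ {s(u, v)})) / G.degree v) := by
  have hswap : s(v, u) = s(u, v) := Sym2.eq_swap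
  rw [flow_of_config_zero hx h, flow_of_config_zero hx (by rwa [hswap]), hswap]

theorem flow_add_flow_of_config_two (hx : 0 < x) (hA : A ∈ config G 2)
    (hflip : A ∆ {s(u, v)} ∈ config G 2) (hdeg : 0 < G.degree u) (hu : u ∈ boundary A)
    (hv : v ∉ boundary A) : flow G x A u v + flow G x A v u =
      1 / 2 * min (x ^ #A / G.degree u) (x ^ #(A ∆ {s(u, v)}) / G.degree v) := by
  rw [flow_of_config_two hx hA hflip hdeg hu, flow_of_notMem_boundary hA hv, add_zero]

theorem flow_add_flow_flip (hx : 0 < x) (huv : G.Adj u v) (hA : A ∈ worm G)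
    (hflip : A ∆ {s(u, v)} ∈ worm G) :
    flow G x (A ∆ {s(u, v)}) u v + flow G x (A ∆ {s(u, v)}) v u =
      flow G x A u v + flow G x A v u := by
  have hinv : A ∆ {s(u, v)} ∆ {s(u, v)} = A := symmDiff_symmDiff_cancel_right _ _
  by_cases h : A ∈ config G 0 ∨ A ∆ {s(u, v)} ∈ config G 0
  · rw [flow_add_flow_of_config_zero hx h, flow_add_flow_of_config_zero hx (by rwa [hinv, or_comm]),
      hinv, min_comm]
  have hA := (mem_union.1 hA).resolve_left fun h₀ => h (Or.inl h₀)
  have hflip := (mem_union.1 hflip).resolve_left fun h₀ => h (Or.inr h₀)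
  wlog hu : u ∈ boundary A ∧ v ∉ boundary A generalizing u v
  · have hswap : s(v, u) = s(u, v) := Sym2.eq_swap
    have hvu := (mem_boundary_or_mem_boundary huv.ne hA hflip).resolve_left hu
    have := this huv.symm (by rwa [hswap]) (by rwa [hswap]) (by rwa [hswap]) (by rwa [hswap]) hvu
    rwa [hswap, add_comm, add_comm (flow G x A v u)] at this
  have hu' : u ∉ boundary (A ∆ {s(u, v)}) := by
    simp [boundary_flip, mem_symmDiff, hu.1]
  have hv' : v ∈ boundary (A ∆ {s(u, v)}) := by
    simp [boundary_flip, mem_symmDiff, hu.2]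
  have hswap : s(v, u) = s(u, v) := Sym2.eq_swap
  have hdeg := (G.degree_pos_iff_exists_adj u).2 ⟨v, huv⟩
  have hdeg' := (G.degree_pos_iff_exists_adj v).2 ⟨u, huv.symm⟩
  rw [add_comm, flow_add_flow_of_config_two hx hflip (by rwa [hswap, hinv]) hdeg' hv' hu',
    flow_add_flow_of_config_two hx hA hflip hdeg hu.1 hu.2, hswap, hinv, min_comm]

theorem le_flow_add_flow (hx : x ∈ Set.Ioc (0 : ℝ) 1) (huv : G.Adj u v) (hA : A ∈ worm G)
    (hflip : A ∆ {s(u, v)} ∈ worm G) :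
    x / (2 * G.maxDegree) * x ^ #A ≤ flow G x A u v + flow G x A v u := by
  have hdeg : ∀ {u v}, G.Adj u v → 0 < G.degree u := fun h =>
    (G.degree_pos_iff_exists_adj _).2 ⟨_, h⟩
  have hdiv : ∀ {y : ℝ} {u v : V}, G.Adj u v → x * x ^ #A ≤ y →
      x * x ^ #A / G.maxDegree ≤ y / G.degree u := fun h hy =>
    div_le_div₀ ((mul_nonneg hx.1.le (pow_nonneg hx.1.le _)).trans hy) hy
      (Nat.cast_pos.2 (hdeg h)) (mod_cast G.degree_le_maxDegree _)
  have hstay : x * x ^ #A ≤ x ^ #A := mul_le_of_le_one_left (pow_nonneg hx.1.le _) hx.2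
  have hmove : x * x ^ #A ≤ x ^ #(A ∆ {s(u, v)}) := mul_pow_card_le_pow_card_flip hx A _
  rw [show x / (2 * G.maxDegree) * x ^ #A = 1 / 2 * (x * x ^ #A / G.maxDegree) by
    rw [← div_div]; ring]
  by_cases h : A ∈ config G 0 ∨ A ∆ {s(u, v)} ∈ config G 0
  · rw [flow_add_flow_of_config_zero hx.1 h]
    have := hdiv huv (le_min hstay hmove)
    have : 0 ≤ min (x ^ #A) (x ^ #(A ∆ {s(u, v)})) / G.degree v :=
      div_nonneg (le_min (pow_nonneg hx.1.le _) (pow_nonneg hx.1.le _)) (Nat.cast_nonneg _)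
    linarith
  have hA := (mem_union.1 hA).resolve_left fun h₀ => h (Or.inl h₀)
  have hflip := (mem_union.1 hflip).resolve_left fun h₀ => h (Or.inr h₀)
  rcases mem_boundary_or_mem_boundary huv.ne hA hflip with ⟨hu, hv⟩ | ⟨hv, hu⟩
  · rw [flow_add_flow_of_config_two hx.1 hA hflip (hdeg huv) hu hv]
    exact mul_le_mul_of_nonneg_left (le_min (hdiv huv hstay) (hdiv huv.symm hmove)) (by norm_num)
  · have hswap : s(v, u) = s(u, v) := Sym2.eq_swap
    rw [add_comm, flow_add_flow_of_config_two hx.1 hA (by rwa [hswap]) (hdeg huv.symm) hv hu, hswap]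
    exact mul_le_mul_of_nonneg_left (le_min (hdiv huv.symm hstay) (hdiv huv hmove)) (by norm_num)

end Flow

section Transition

variable {V : Type*} [Fintype V] [DecidableEq V] {G : SimpleGraph V} [DecidableRel G.Adj] {x : ℝ}

theorem accept_nonneg (hx : 0 ≤ x) (A : Finset (Sym2 V)) (u v : V) : 0 ≤ accept G x A u v := by
  have := flipFactor_nonneg hx A s(u, v)
  rw [accept]
  split_ifs <;> positivity

theorem accept_le_half (x : ℝ) (A : Finset (Sym2 V)) (u v : V) : accept G x A u v ≤ 1 / 2 := by
  rw [accept]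
  split_ifs <;> exact mul_le_of_le_one_right (by norm_num) (min_le_left _ _)

theorem startSet_nonempty [Nonempty V] (A : State G) : (startSet G A.1).Nonempty := by
  rcases mem_union.1 A.2 with hA | hA
  · rw [startSet_of_zero hA]
    exact univ_nonempty
  · rw [startSet_of_two hA, ← card_pos, (mem_config.1 hA).2]
    exact two_pos

theorem weight_eq (A : State G) : weight G x A = x ^ #A.1 * #(startSet G A.1) := by
  rcases mem_union.1 A.2 with hA | hA
  · rw [weight, startSet_of_zero hA, if_pos hA, card_univ]
  · rw [weight, startSet_of_two hA, if_neg (notMem_config_zero hA), (mem_config.1 hA).2,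
      Nat.cast_ofNat]

theorem weight_pos [Nonempty V] (hx : 0 < x) (A : State G) : 0 < weight G x A := by
  rw [weight_eq]
  exact mul_pos (pow_pos hx _) (Nat.cast_pos.2 (startSet_nonempty A).card_pos)

theorem weight_le [Nontrivial V] (hx : 0 ≤ x) (A : State G) :
    weight G x A ≤ x ^ #A.1 * Fintype.card V := by
  rw [weight]
  refine mul_le_mul_of_nonneg_left ?_ (pow_nonneg hx _)
  split_ifs
  · exact le_rfl
  · exact mod_cast Fintype.one_lt_card (α := V)

theorem pow_card_le_weight [Nonempty V] (hx : 0 ≤ x) (A : State G) : x ^ #A.1 ≤ weight G x A := by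
  rw [weight]
  refine le_mul_of_one_le_right (pow_nonneg hx _) ?_
  split_ifs
  · exact mod_cast Fintype.card_pos (α := V)
  · exact one_le_two

theorem transition_eq_expect (A B : State G) : transition G x A B =
    𝔼 u ∈ startSet G A.1, 𝔼 v ∈ G.neighborFinset u,
      ((if B.1 = A.1 ∆ {s(u, v)} then accept G x A.1 u v else 0) +
        if B = A then 1 - accept G x A.1 u v else 0) := by
  simp only [transition, expect_eq_sum_div_card, SimpleGraph.card_neighborFinset_eq_degree,
    mul_sum, div_eq_inv_mul, mul_one]

theorem half_le_transition [Nonempty V] (hdeg : ∀ u, 0 < G.degree u) (A : State G) :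
    1 / 2 ≤ transition G x A A := by
  rw [transition_eq_expect]
  refine le_expect (startSet_nonempty A) fun u _ => le_expect (card_pos.1 (hdeg u)) fun v _ => ?_
  have hne : A.1 ≠ A.1 ∆ {s(u, v)} := fun h =>
    singleton_ne_empty s(u, v) (symmDiff_eq_left.1 h.symm)
  rw [if_neg hne, if_pos rfl]
  linarith [accept_le_half (G := G) x A.1 u v]

theorem transition_nonneg (hx : 0 ≤ x) (A B : State G) : 0 ≤ transition G x A B := by
  rw [transition_eq_expect]
  refine expect_nonneg fun u _ => expect_nonneg fun v _ => add_nonneg ?_ ?_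
  · exact ite_nonneg (accept_nonneg hx _ _ _) le_rfl
  · exact ite_nonneg (by linarith [accept_le_half (G := G) x A.1 u v]) le_rfl

theorem transition_mem_rowStochastic [Nonempty V] (hdeg : ∀ u, 0 < G.degree u) (hx : 0 ≤ x) :
    transition G x ∈ Matrix.rowStochastic ℝ (State G) := by
  refine Matrix.mem_rowStochastic_iff_sum.2 ⟨transition_nonneg hx, fun A => ?_⟩
  have hrow : ∀ u ∈ startSet G A.1, ∀ v ∈ G.neighborFinset u,
      ∑ B : State G, ((if B.1 = A.1 ∆ {s(u, v)} then accept G x A.1 u v else 0) +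
        if B = A then 1 - accept G x A.1 u v else 0) = 1 := fun u hu v hv => by
    have hflip := flip_mem_worm A.2 ((G.mem_neighborFinset u v).1 hv) hu
    have hval : ∀ B : State G, B.1 = A.1 ∆ {s(u, v)} ↔ B = ⟨_, hflip⟩ := fun B =>
      (Subtype.ext_iff (a2 := ⟨_, hflip⟩)).symm
    simp only [hval, sum_add_distrib, sum_ite_eq', mem_univ, if_true, add_sub_cancel]
  simp only [transition_eq_expect, ← expect_sum_comm]
  exact (expect_congr rfl fun u hu => (expect_congr rfl (hrow u hu)).trans
    (expect_const (card_pos.1 (hdeg u)) 1)).trans (expect_const (startSet_nonempty A) 1)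

theorem weight_mul_transition {A B : State G} (hAB : B ≠ A) :
    weight G x A * transition G x A B =
      ∑ u, ∑ v ∈ G.neighborFinset u, if B.1 = A.1 ∆ {s(u, v)} then flow G x A.1 u v else 0 := by
  rw [weight_eq, transition_eq_expect, mul_assoc, card_mul_expect, mul_sum,
    ← sum_subset (subset_univ (startSet G A.1)) fun u _ hu => by simp [flow, hu]]
  refine sum_congr rfl fun u hu => ?_
  rw [expect_eq_sum_div_card, sum_div, mul_sum]
  refine sum_congr rfl fun v _ => ?_
  rw [if_neg hAB, add_zero, flow, if_pos hu, SimpleGraph.card_neighborFinset_eq_degree]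
  split_ifs <;> simp

theorem sum_sum_neighborFinset_ite {u v : V} (huv : G.Adj u v) (f : V → V → ℝ) :
    (∑ a, ∑ b ∈ G.neighborFinset a, if s(a, b) = s(u, v) then f a b else 0) = f u v + f v u := by
  have hdart : ∀ p : V × V, p ∈ ({(u, v), (v, u)} : Finset (V × V)) ↔
      p.1 ∈ univ ∧ p.2 ∈ {b ∈ G.neighborFinset p.1 | s(p.1, b) = s(u, v)} := fun p => by
    simp only [mem_insert, mem_singleton, mem_univ, true_and, mem_filter, G.mem_neighborFinset,
      Prod.ext_iff, Sym2.eq_iff]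
    constructor
    · rintro (⟨hu, hv⟩ | ⟨hv, hu⟩) <;> simp [hu, hv, huv, huv.symm]
    · exact And.right
  have hne : (u, v) ≠ (v, u) := fun h => huv.ne (Prod.ext_iff.1 h).1
  simp only [← sum_filter]
  rw [← sum_finset_product' _ _ _ hdart, sum_pair hne]

theorem weight_mul_transition_flip {A B : State G} {u v : V} (huv : G.Adj u v)
    (hB : B.1 = A.1 ∆ {s(u, v)}) :
    weight G x A * transition G x A B = flow G x A.1 u v + flow G x A.1 v u := by
  have hBA : B ≠ A := fun h =>
    singleton_ne_empty s(u, v) (symmDiff_eq_left.1 (hB.symm.trans (congrArg Subtype.val h)))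
  rw [weight_mul_transition hBA, ← sum_sum_neighborFinset_ite huv]
  simp only [hB, symmDiff_right_inj, singleton_inj, eq_comm]

theorem weight_mul_transition_comm (hx : 0 < x) (A B : State G) :
    weight G x A * transition G x A B = weight G x B * transition G x B A := by
  obtain rfl | hBA := eq_or_ne B A
  · rfl
  have hinv : ∀ e, B.1 = A.1 ∆ {e} ↔ A.1 = B.1 ∆ {e} := fun e => by
    constructor <;> rintro h <;> rw [h, symmDiff_symmDiff_cancel_right]
  by_cases hflip : ∃ u v, G.Adj u v ∧ B.1 = A.1 ∆ {s(u, v)}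
  · obtain ⟨u, v, huv, hB⟩ := hflip
    rw [weight_mul_transition_flip huv hB, weight_mul_transition_flip huv ((hinv _).1 hB), hB,
      flow_add_flow_flip hx huv A.2 (hB ▸ B.2)]
  · have hne : ∀ u, ∀ v ∈ G.neighborFinset u, B.1 ≠ A.1 ∆ {s(u, v)} := fun u v hv hB =>
      hflip ⟨u, v, (G.mem_neighborFinset u v).1 hv, hB⟩
    rw [weight_mul_transition hBA, weight_mul_transition hBA.symm]
    exact sum_congr rfl fun u _ => sum_congr rfl fun v hv => by
      rw [if_neg (hne u v hv), if_neg (mt (hinv _).2 (hne u v hv))]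

end Transition

section Poincare

variable {V : Type*} [Fintype V] [DecidableEq V] {G : SimpleGraph V} [DecidableRel G.Adj] {x : ℝ}

theorem sum_weight_mul_sub_sq_le [Nontrivial V] (hx : x ∈ Set.Ioc (0 : ℝ) 1)
    (g : Finset (Sym2 V) → ℝ) :
    ∑ A : State G, weight G x A * (g A.1 - (config G 0).centerMass (fun F => x ^ #F) g) ^ 2 ≤
      #G.edgeFinset * (Fintype.card V : ℝ) ^ 3 *
        ∑ A ∈ worm G, ∑ e ∈ G.edgeFinset, flipEnergy G x g A e := by
  set c := (config G 0).centerMass (fun F => x ^ #F) g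
  set Λ := ∑ F ∈ config G 0, x ^ #F
  have hΛ : 0 < Λ := sum_pos (fun F _ => pow_pos hx.1 _) ⟨∅, empty_mem_config_zero⟩
  refine le_of_mul_le_mul_left ?_ hΛ
  calc Λ * ∑ A : State G, weight G x A * (g A.1 - c) ^ 2
      ≤ Λ * ∑ A : State G, x ^ #A.1 * Fintype.card V * (g A.1 - c) ^ 2 :=
        mul_le_mul_of_nonneg_left (sum_le_sum fun A _ =>
          mul_le_mul_of_nonneg_right (weight_le hx.1.le A) (sq_nonneg _)) hΛ.le
    _ = Fintype.card V * ∑ A ∈ worm G, x ^ #A * (Λ * (g A - c) ^ 2) := by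
        rw [← sum_coe_sort (worm G), mul_sum, mul_sum]
        exact sum_congr rfl fun A _ => by ring
    _ ≤ Fintype.card V * ∑ A ∈ worm G, x ^ #A * ∑ F ∈ config G 0, x ^ #F * (g A - g F) ^ 2 :=
        mul_le_mul_of_nonneg_left (sum_le_sum fun A _ => mul_le_mul_of_nonneg_left
          (sum_mul_sub_centerMass_sq_le (fun F _ => pow_nonneg hx.1.le _) hΛ g (g A))
          (pow_nonneg hx.1.le _)) (Nat.cast_nonneg _)
    _ = Fintype.card V *
          ∑ F ∈ config G 0, ∑ A ∈ worm G, x ^ #A * x ^ #F * (g A - g F) ^ 2 := by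
        rw [sum_comm]
        simp only [mul_assoc, ← mul_sum]
    _ ≤ Fintype.card V * (#G.edgeFinset * (Fintype.card V : ℝ) ^ 2 * Λ *
          ∑ A ∈ worm G, ∑ e ∈ G.edgeFinset, flipEnergy G x g A e) :=
        mul_le_mul_of_nonneg_left (sum_worm_sq_sub_le ⟨hx.1.le, hx.2⟩ g) (Nat.cast_nonneg _)
    _ = _ := by ring

theorem pow_card_le_weight_mul_transition (hx : x ∈ Set.Ioc (0 : ℝ) 1)
    {A B : State G} {e : Sym2 V} (he : e ∈ G.edgeFinset) (hB : B.1 = A.1 ∆ {e}) :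
    x ^ #A.1 ≤ 2 * G.maxDegree / x * (weight G x A * transition G x A B) := by
  induction e with
  | h u v =>
    have huv : G.Adj u v := SimpleGraph.mem_edgeFinset.1 he
    have hΔ : (0 : ℝ) < G.maxDegree := Nat.cast_pos.2 <|
      ((G.degree_pos_iff_exists_adj u).2 ⟨v, huv⟩).trans_le (G.degree_le_maxDegree u)
    rw [weight_mul_transition_flip huv hB, ← inv_mul_le_iff₀ (div_pos (by positivity) hx.1),
      inv_div]
    exact le_flow_add_flow hx huv A.2 (hB ▸ B.2)

theorem flipEnergy_le (hx : x ∈ Set.Ioc (0 : ℝ) 1) (g : Finset (Sym2 V) → ℝ)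
    (A : State G) {e : Sym2 V} (he : e ∈ G.edgeFinset) :
    flipEnergy G x g A.1 e ≤ ∑ B : State G, if B.1 = A.1 ∆ {e} then
      2 * G.maxDegree / x * (weight G x A * transition G x A B) * (g A.1 - g B.1) ^ 2 else 0 := by
  rw [flipEnergy]
  split_ifs with hflip
  · have hval : ∀ B : State G, B.1 = A.1 ∆ {e} ↔ B = ⟨_, hflip⟩ := fun B =>
      (Subtype.ext_iff (a2 := ⟨_, hflip⟩)).symm
    simp only [hval, sum_ite_eq', mem_univ, if_true]
    exact mul_le_mul_of_nonneg_right (pow_card_le_weight_mul_transition hx he rfl) (sq_nonneg _)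
  · exact sum_nonneg fun B _ => (if_neg fun hB : B.1 = A.1 ∆ {e} => hflip (hB ▸ B.2)).ge

theorem sum_flipEnergy_le [Nonempty V] (hx : x ∈ Set.Ioc (0 : ℝ) 1) (g : Finset (Sym2 V) → ℝ) :
    ∑ A ∈ worm G, ∑ e ∈ G.edgeFinset, flipEnergy G x g A e ≤
      4 * G.maxDegree / x * dirichletForm (transition G x) (weight G x) fun A => g A.1 := by
  set K : State G → State G → ℝ := fun A B =>
    2 * G.maxDegree / x * (weight G x A * transition G x A B) * (g A.1 - g B.1) ^ 2
  have hK : ∀ A B, 0 ≤ K A B := fun A B => by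
    have := hx.1
    have := (weight_pos hx.1 A).le
    have := transition_nonneg hx.1.le A B
    positivity
  have hfiber : ∀ A B : State G, #{e ∈ G.edgeFinset | B.1 = A.1 ∆ {e}} ≤ 1 := fun A B =>
    card_le_one.2 fun e he e' he' => singleton_injective <| symmDiff_right_injective A.1 <|
      (mem_filter.1 he).2.symm.trans (mem_filter.1 he').2
  calc ∑ A ∈ worm G, ∑ e ∈ G.edgeFinset, flipEnergy G x g A e
      = ∑ A : State G, ∑ e ∈ G.edgeFinset, flipEnergy G x g A.1 e := (sum_coe_sort _ _).symm
    _ ≤ ∑ A, ∑ e ∈ G.edgeFinset, ∑ B : State G, if B.1 = A.1 ∆ {e} then K A B else 0 :=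
        sum_le_sum fun A _ => sum_le_sum fun e he => flipEnergy_le hx g A he
    _ = ∑ A, ∑ B : State G, #{e ∈ G.edgeFinset | B.1 = A.1 ∆ {e}} • K A B :=
        sum_congr rfl fun A _ => by
          rw [sum_comm]
          simp only [← sum_filter, sum_const]
    _ ≤ ∑ A, ∑ B, K A B := sum_le_sum fun A _ => sum_le_sum fun B _ => by
        simpa only [one_smul] using smul_le_smul_of_nonneg_right (hfiber A B) (hK A B)
    _ = 4 * G.maxDegree / x * dirichletForm (transition G x) (weight G x) fun A => g A.1 := by
        simp only [K, dirichletForm, mul_assoc, ← mul_sum]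
        ring

theorem sum_weight_pos [Nonempty V] (hx : 0 < x) : 0 < ∑ A : State G, weight G x A :=
  sum_pos (fun A _ => weight_pos hx A)
    ⟨⟨∅, mem_union_left _ empty_mem_config_zero⟩, mem_univ _⟩

theorem stationary_eq_smul (G : SimpleGraph V) [DecidableRel G.Adj] (x : ℝ) :
    stationary G x = (∑ A : State G, weight G x A)⁻¹ • weight G x := by
  ext A
  rw [stationary, Pi.smul_apply, smul_eq_mul, div_eq_inv_mul]

theorem stationary_mem_stdSimplex [Nonempty V] (hx : 0 < x) :
    stationary G x ∈ stdSimplex ℝ (State G) := by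
  refine ⟨fun A => div_nonneg (weight_pos hx A).le (sum_weight_pos hx).le, ?_⟩
  simp only [stationary]
  rw [← sum_div, div_self (sum_weight_pos hx).ne']

theorem stationary_vecMul_transition [Nonempty V] (hdeg : ∀ u, 0 < G.degree u) (hx : 0 < x) :
    Matrix.vecMul (stationary G x) (transition G x) = stationary G x :=
  vecMul_eq_self_of_detailedBalance (transition_mem_rowStochastic hdeg hx.le) fun A B => by
    rw [stationary, stationary, div_mul_eq_mul_div, div_mul_eq_mul_div,
      weight_mul_transition_comm hx]

theorem poincareInequality [Nontrivial V] (hx : x ∈ Set.Ioc (0 : ℝ) 1) :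
    PoincareInequality (transition G x) (stationary G x)
      (4 * G.maxDegree * (Fintype.card V : ℝ) ^ 3 * #G.edgeFinset / x) := fun f => by
  set g : Finset (Sym2 V) → ℝ := Function.extend Subtype.val f 0
  have hg : ∀ A : State G, g A.1 = f A := Subtype.val_injective.extend_apply f 0
  set c := (config G 0).centerMass (fun F => x ^ #F) g
  set Z := ∑ A : State G, weight G x A
  have hmoment : ∑ A : State G, weight G x A * (f A - c) ^ 2 ≤ #G.edgeFinset *
      (Fintype.card V : ℝ) ^ 3 * ∑ A ∈ worm G, ∑ e ∈ G.edgeFinset, flipEnergy G x g A e := by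
    simpa only [hg] using sum_weight_mul_sub_sq_le (G := G) hx g
  have hflip : ∑ A ∈ worm G, ∑ e ∈ G.edgeFinset, flipEnergy G x g A e ≤
      4 * G.maxDegree / x * dirichletForm (transition G x) (weight G x) f := by
    simpa only [hg] using sum_flipEnergy_le (G := G) hx g
  calc variance (stationary G x) f ≤ ∑ A, stationary G x A * (f A - c) ^ 2 := by
        rw [dotProduct_sub_const_sq (stationary_mem_stdSimplex hx.1)]
        exact le_add_of_nonneg_right (sq_nonneg _)
    _ = Z⁻¹ * ∑ A : State G, weight G x A * (f A - c) ^ 2 := by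
        simp only [stationary_eq_smul, Pi.smul_apply, smul_eq_mul, mul_assoc, ← mul_sum, Z]
    _ ≤ Z⁻¹ * (#G.edgeFinset * (Fintype.card V : ℝ) ^ 3 *
          (4 * G.maxDegree / x * dirichletForm (transition G x) (weight G x) f)) :=
        mul_le_mul_of_nonneg_left
          (hmoment.trans (mul_le_mul_of_nonneg_left hflip (by positivity)))
          (inv_nonneg.2 (sum_weight_pos hx.1).le)
    _ = _ := by
        rw [stationary_eq_smul, dirichletForm_smul]
        ring

end Poincare

section NoIsolatedVertices

variable {V : Type*} [Fintype V] {G : SimpleGraph V} [DecidableRel G.Adj]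

theorem card_le_two_mul_card_edgeFinset (hdeg : ∀ u, 0 < G.degree u) :
    Fintype.card V ≤ 2 * #G.edgeFinset := by
  rw [← G.sum_degrees_eq_twice_card_edges, ← card_univ, card_eq_sum_ones]
  exact sum_le_sum fun u _ => hdeg u

theorem card_edgeFinset_pos [Nonempty V] (hdeg : ∀ u, 0 < G.degree u) : 0 < #G.edgeFinset := by
  have := card_le_two_mul_card_edgeFinset hdeg
  have := Fintype.card_pos (α := V)
  omega

end NoIsolatedVertices

section MixingTime

variable {V : Type*} [Fintype V] [DecidableEq V] {G : SimpleGraph V} [DecidableRel G.Adj] {x : ℝ}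

theorem card_worm_le : #(worm G) ≤ 2 ^ #G.edgeFinset := by
  rw [← card_powerset]
  exact card_le_card (union_subset (filter_subset _ _) (filter_subset _ _))

theorem sum_weight_le [Nontrivial V] (hdeg : ∀ u, 0 < G.degree u) (hx : x ∈ Set.Icc (0 : ℝ) 1) :
    ∑ A : State G, weight G x A ≤ 4 ^ #G.edgeFinset := by
  have hcard : Fintype.card V ≤ 2 ^ #G.edgeFinset :=
    (card_le_two_mul_card_edgeFinset hdeg).trans <| by
      obtain ⟨k, hk⟩ := Nat.exists_eq_add_of_lt (card_edgeFinset_pos hdeg)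
      rw [hk, zero_add, pow_succ']
      exact Nat.mul_le_mul_left 2 Nat.lt_two_pow_self
  calc ∑ A : State G, weight G x A ≤ ∑ _A : State G, (2 : ℝ) ^ #G.edgeFinset :=
        sum_le_sum fun A _ => (weight_le hx.1 A).trans <|
          (mul_le_of_le_one_left (Nat.cast_nonneg _) (pow_le_one₀ hx.1 hx.2)).trans
            (mod_cast hcard)
    _ = #(worm G) * 2 ^ #G.edgeFinset := by
        rw [sum_const, nsmul_eq_mul, card_univ, Fintype.card_coe, worm]
    _ ≤ 2 ^ #G.edgeFinset * 2 ^ #G.edgeFinset :=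
        mul_le_mul_of_nonneg_right (mod_cast card_worm_le) (by positivity)
    _ = 4 ^ #G.edgeFinset := by
        rw [← mul_pow]
        norm_num

theorem le_stationary [Nontrivial V] (hdeg : ∀ u, 0 < G.degree u) (hx : x ∈ Set.Ioc (0 : ℝ) 1)
    (A : State G) : (x / 4) ^ #G.edgeFinset ≤ stationary G x A := by
  have hA : A.1 ⊆ G.edgeFinset := (mem_worm.1 A.2).1
  rw [stationary, div_pow]
  refine div_le_div₀ (weight_pos hx.1 A).le ?_ (sum_weight_pos hx.1)
    (sum_weight_le hdeg ⟨hx.1.le, hx.2⟩)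
  exact (pow_le_pow_of_le_one hx.1.le hx.2 (card_le_card hA)).trans
    (pow_card_le_weight hx.1.le A)

theorem exists_isMixingTime_le [Nontrivial V] (hdeg : ∀ u, 0 < G.degree u)
    (hx : x ∈ Set.Ioc (0 : ℝ) 1) {δ : ℝ} (hδ : 0 < δ) :
    ∃ t, IsMixingTime (transition G x) (stationary G x) δ t ∧
      t ≤ ⌈4 * G.maxDegree * (Fintype.card V : ℝ) ^ 3 * #G.edgeFinset / x *
        (#G.edgeFinset * Real.log (4 / x) - 2 * Real.log δ)⌉₊ := by
  have hC : 1 ≤ 4 * G.maxDegree * (Fintype.card V : ℝ) ^ 3 * #G.edgeFinset / x := by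
    have hΔ : 0 < G.maxDegree :=
      (hdeg (Classical.arbitrary V)).trans_le (G.degree_le_maxDegree _)
    have hm := card_edgeFinset_pos hdeg
    rw [le_div_iff₀ hx.1, one_mul]
    refine hx.2.trans ?_
    exact_mod_cast (by positivity : 0 < 4 * G.maxDegree * Fintype.card V ^ 3 * #G.edgeFinset)
  have hlog : -Real.log ((x / 4) ^ #G.edgeFinset) = #G.edgeFinset * Real.log (4 / x) := by
    rw [Real.log_pow, ← mul_neg, ← Real.log_inv, inv_div]
  have : Nonempty (State G) := ⟨⟨∅, mem_union_left _ empty_mem_config_zero⟩⟩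
  rw [← hlog]
  exact (poincareInequality hx).exists_isMixingTime_le hC
    (transition_mem_rowStochastic hdeg hx.1.le) (half_le_transition hdeg)
    (stationary_mem_stdSimplex hx.1) (stationary_vecMul_transition hdeg hx.1)
    (pow_pos (div_pos hx.1 four_pos) _) (le_stationary hdeg hx) hδ

end MixingTime

theorem ceil_four_mul_le {B m L ℓ : ℝ} (hB : 1 ≤ B) (hm : 1 ≤ m) (hL : 0 ≤ L) (hℓ : 0 ≤ ℓ) :
    (⌈4 * B * (m * L + 2 * ℓ)⌉₊ : ℝ) ≤ 12 * B * (m * (L + Real.log 2) + ℓ) := by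
  have hlog2 : 1 / 2 ≤ Real.log 2 := by linarith [Real.log_two_gt_d9]
  have hround : 1 ≤ 12 * B * (m * Real.log 2) := by
    have : 1 / 2 ≤ m * Real.log 2 := hlog2.trans (le_mul_of_one_le_left (by linarith) hm)
    nlinarith
  have hBL : 0 ≤ B * (m * L) := by positivity
  have hBℓ : 0 ≤ B * ℓ := by positivity
  calc (⌈4 * B * (m * L + 2 * ℓ)⌉₊ : ℝ) ≤ 4 * B * (m * L + 2 * ℓ) + 1 :=
        (Nat.ceil_lt_add_one (by positivity)).le
    _ ≤ 12 * B * (m * (L + Real.log 2) + ℓ) := by linarith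

theorem ceil_relaxation_bound_le {n m d x δ : ℝ} (hn : 2 ≤ n) (hm : 1 ≤ m) (hd : 1 ≤ d)
    (hx : x ∈ Set.Ioc (0 : ℝ) 1) (hδ : δ ∈ Set.Ioc (0 : ℝ) 1) :
    (⌈4 * d * n ^ 3 * m / x * (m * Real.log (4 / x) - 2 * Real.log δ)⌉₊ : ℝ) ≤
      1 / (2 * x) * (Real.log (8 / x) - Real.log δ / m) * (3 + 1 / (m * x)) * d * n ^ 6 *
        m ^ 2 := by
  obtain ⟨hx0, hx1⟩ := hx
  have : 0 < m := one_pos.trans_le hm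
  set L := Real.log (4 / x)
  have hL0 : 0 ≤ L := Real.log_nonneg ((one_le_div hx0).2 (by linarith))
  have hℓ0 : 0 ≤ -Real.log δ := neg_nonneg.2 (Real.log_nonpos hδ.1.le hδ.2)
  have hL : Real.log (8 / x) = L + Real.log 2 := by
    rw [← Real.log_mul (by positivity) two_ne_zero]
    ring_nf
  set B := d * n ^ 3 * m / x with hB
  have hn3 : 8 ≤ n ^ 3 := by
    calc (8 : ℝ) = 2 ^ 3 := by norm_num
      _ ≤ n ^ 3 := pow_le_pow_left₀ zero_le_two hn 3
  have hB1 : 1 ≤ B := by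
    rw [hB, le_div_iff₀ hx0, one_mul]
    exact hx1.trans (one_le_mul_of_one_le_of_one_le
      (one_le_mul_of_one_le_of_one_le hd (by linarith)) hm)
  have hfactor : 8 * 3 ≤ n ^ 3 * (3 + 1 / (m * x)) :=
    mul_le_mul hn3 (le_add_of_nonneg_right (by positivity)) zero_le_three (by positivity)
  calc (⌈4 * d * n ^ 3 * m / x * (m * L - 2 * Real.log δ)⌉₊ : ℝ)
      = (⌈4 * B * (m * L + 2 * -Real.log δ)⌉₊ : ℝ) := by
        rw [hB]
        ring_nf
    _ ≤ 12 * B * (m * (L + Real.log 2) + -Real.log δ) := ceil_four_mul_le hB1 hm hL0 hℓ0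
    _ = B / 2 * (m * (L + Real.log 2) + -Real.log δ) * (8 * 3) := by ring
    _ ≤ B / 2 * (m * (L + Real.log 2) + -Real.log δ) * (n ^ 3 * (3 + 1 / (m * x))) :=
        mul_le_mul_of_nonneg_left hfactor (by positivity)
    _ = _ := by
        rw [hL, hB]
        field_simp
        ring

end Worm

theorem theorem1_general {V : Type*} [Fintype V] [DecidableEq V] [Nonempty V]
    (G : SimpleGraph V) [DecidableRel G.Adj] (hdeg : ∀ u, 0 < G.degree u)
    (x : ℝ) (hx : x ∈ Set.Ioc (0 : ℝ) 1) (δ : ℝ) (hδ : δ ∈ Set.Ioc (0 : ℝ) 1) :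
    ∃ t : ℕ,
      MarkovMixing.IsMixingTime (Worm.transition G x) (Worm.stationary G x) δ t ∧
      (t : ℝ) ≤ 1 / (2 * x)
        * (Real.log (8 / x) - Real.log δ / (G.edgeFinset.card : ℝ))
        * (3 + 1 / ((G.edgeFinset.card : ℝ) * x))
        * (G.maxDegree : ℝ) * (Fintype.card V : ℝ) ^ 6 * (G.edgeFinset.card : ℝ) ^ 2 := by
  let u := Classical.arbitrary V
  obtain ⟨v, huv⟩ := (G.degree_pos_iff_exists_adj u).1 (hdeg u)
  have : Nontrivial V := ⟨u, v, huv.ne⟩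
  obtain ⟨t, ht, hle⟩ := Worm.exists_isMixingTime_le hdeg hx hδ.1
  have hn : 2 ≤ (Fintype.card V : ℝ) := mod_cast Fintype.one_lt_card (α := V)
  have hm : 1 ≤ (G.edgeFinset.card : ℝ) := mod_cast Worm.card_edgeFinset_pos hdeg
  have hd : 1 ≤ (G.maxDegree : ℝ) := mod_cast (hdeg u).trans_le (G.degree_le_maxDegree u)
  exact ⟨t, ht, (Nat.cast_le.2 hle).trans (Worm.ceil_relaxation_bound_le hn hm hd hx hδ)⟩

theorem theorem1 {V : Type*} [Fintype V] [DecidableEq V]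
    (G : SimpleGraph V) [DecidableRel G.Adj] (hG : G.Connected) (hn : 2 ≤ Fintype.card V)
    (x : ℝ) (hx : x ∈ Set.Ioo (0 : ℝ) 1) (δ : ℝ) (hδ : δ ∈ Set.Ioo (0 : ℝ) 1) :
    ∃ t : ℕ,
      MarkovMixing.IsMixingTime (Worm.transition G x) (Worm.stationary G x) δ t ∧
      (t : ℝ) ≤ 1 / (2 * x)
        * (Real.log (8 / x) - Real.log δ / (G.edgeFinset.card : ℝ))
        * (3 + 1 / ((G.edgeFinset.card : ℝ) * x))
        * (G.maxDegree : ℝ) * (Fintype.card V : ℝ) ^ 6 * (G.edgeFinset.card : ℝ) ^ 2 := by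
  have : Nontrivial V := Fintype.one_lt_card_iff_nontrivial.1 hn
  have : Nonempty V := hG.nonempty
  exact theorem1_general G (fun u => hG.preconnected.degree_pos_of_nontrivial u) x
    ⟨hx.1, hx.2.le⟩ δ ⟨hδ.1, hδ.2.le⟩
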